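/- Let $\beta\in(0,2)\setminus\{1\}$ and let $(X_k)_{k\ge1}$ be i.i.d. non-negative random variables whose tail is regularly varying with index $-\beta$, i.e. $\lim_{x\to\infty}\mathbb P[X_1>\Lambda x]/\mathbb P[X_1>x]=\Lambda^{-\beta}$ for every $\Lambda>0$. Put $S_0=0$, $S_n=\sum_{k=1}^nX_k$, and let $b_n=0$ if $\beta\in(0,1)$, $b_n=\mathbb E[S_n]$ if $\beta\in(1,2)$. For $s\ge 0$ let $1+a(s)=\mathbb E[e^{-sX_1}]$ if $\beta\in(0,1)$ and $1+a(s)=\mathbb E[e^{-s(X_1-\mathbb E[X_1])}]$ if $\beta\in(1,2)$. Let $(N(t))_{t\ge0}$ be a family of random variables with values in $\{0,1,2,\dots\}$, independent of $(X_k)_{k\ge1}$, with $\mathbb E[N(t)]<\infty$ for every $t$ and $\mathbb E[N(t)]\to\infty$ as $t\to\infty$, and let $\phi_{N(t)}(z)=\sum_{n\ge0}\mathbb P[N(t)=n]\,z^n$ be the generating function of $N(t)$. Let $(s_t)_{t\ge0}$ be positive numbers with $s_t\to0$ as $t\to\infty$ such that, for every $\lambda>0$, $\phi_{N(t)}$ is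 differentiable at $1+a(\lambda s_t)$ for all large $t$ and $$\lim_{t\to\infty}\left|\frac{\phi'_{N(t)}(1+a(\lambda s_t))}{\mathbb E[N(t)]}-1\right|=0 .$$ Then, with $x_t=1/s_t$, $$\lim_{t\to\infty}\ \sup_{x\ge x_t}\left|\frac{\mathbb P[S_{N(t)}-b_{N(t)}>x]}{\mathbb E[N(t)]\,\mathbb P[X_1>x]}-1\right|=0 .$$ -/

import Mathlib

open MeasureTheory ProbabilityTheory Filter Topology
open scoped NNReal ENNReal

noncomputable section

namespace RandomSum

variable {Ω : Type*} [MeasurableSpace Ω]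

/-- The tail distribution function `x ↦ P[Y > x]`. -/
def tail (P : Measure Ω) (Y : Ω → ℝ) (x : ℝ) : ℝ :=
  P.real {ω | x < Y ω}

/-- `F` is regularly varying at infinity with index `-ρ`. -/
def RegularlyVarying (F : ℝ → ℝ) (ρ : ℝ) : Prop :=
  ∀ c : ℝ, 0 < c → Tendsto (fun x => F (c * x) / F x) atTop (𝓝 (c ^ (-ρ)))

/-- The partial sum `S_n` of the first `n` summands; the first summand is `X 0`. -/
def partialSum (X : ℕ → Ω → ℝ) (n : ℕ) (ω : Ω) : ℝ :=
  ∑ k ∈ Finset.range n, X k ω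

/-- The centering `b_n`: zero if `β < 1`, and `E[S_n]` otherwise. -/
def centering (P : Measure Ω) (X : ℕ → Ω → ℝ) (β : ℝ) (n : ℕ) : ℝ :=
  if β < 1 then 0 else ∫ ω, partialSum X n ω ∂P

/-- The (bilateral) Laplace-Stieltjes transform `s ↦ E[exp(-s Y)]` of the law of `Y`. -/
def laplace (P : Measure Ω) (Y : Ω → ℝ) (s : ℝ) : ℝ :=
  ∫ ω, Real.exp (-s * Y ω) ∂P

/-- `a(s)`: the transform of the summand (centered unless `β < 1`) is `1 + a(s)`. -/
def a (P : Measure Ω) (Y : Ω → ℝ) (β : ℝ) (s : ℝ) : ℝ :=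
  if β < 1 then laplace P Y s - 1
  else laplace P (fun ω => Y ω - ∫ ω', Y ω' ∂P) s - 1

/-- The probability generating function `φ_M(z) = ∑ P[M = n] z ^ n` of an `ℕ`-valued `M`.
It takes the value `0` at every `z ≥ 0` at which the series diverges. -/
def pgf (P : Measure Ω) (M : Ω → ℕ) (z : ℝ) : ℝ :=
  ∑' n : ℕ, P.real {ω | M ω = n} * z ^ n

/-- The expectation of an `ℕ`-valued random variable. -/
def mean (P : Measure Ω) (M : Ω → ℕ) : ℝ :=
  ∫ ω, (M ω : ℝ) ∂P

/-- The randomly centered random sum `S_M - b_M`. -/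
def centeredRandomSum (P : Measure Ω) (X : ℕ → Ω → ℝ) (β : ℝ) (M : Ω → ℕ) (ω : Ω) : ℝ :=
  partialSum X (M ω) ω - centering P X β (M ω)

end RandomSum

end

namespace RandomSum

/-! The proof rests on the principle of a single big jump. Write `F` for the tail of `X 0` and `m`
for the centering per summand, so that `b_n = n * m`. Truncate the summands at `η * x`. For small
`η` the truncated centered sum rarely deviates by order `x`: Markov's inequality shows this for `β <
1` and Chebyshev's for `1 < β < 2`, with truncated moments bounded as in Karamata's theorem. A large
sum therefore needs a summand of size about `x`. This gives `P[S_n - b_n > x] ≤ C * n * F x` for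
every `n` (`exists_tail_sum_le`), and relative error `ε` as long as `n * F x ≤ κ`
(`exists_abs_tail_sum_sub_le`).

Conditioning on `N t` (`abs_tail_sub_le`) leaves one thing to show: with `q = F (1 / s t)`, values
`n` with `n * q > κ` contribute a negligible share of `E[N t]`. Since `F x ≤ q` for all `x ≥ 1 / s
t`, this single estimate makes the result uniform in `x`.

The hypothesis on the generating function supplies it. At `z = 1 + a(2 * s t)` the difference `φ'(z)
- E[N] = ∑ P[N = n] * n * (z ^ (n - 1) - 1)` has terms of one sign, and `|z - 1| ≥ c * q`
(`exists_eventually_mul_tail_le_abs_a`). Hence each term with `n * q > κ` is at least a fixed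
fraction of `P[N = n] * n` in absolute value, while the whole difference is `o(E[N])`
(`tendsto_meanAbove_div_mean`). -/

lemma tail_nonneg {Ω : Type*} [MeasurableSpace Ω] {P : Measure Ω} {Y : Ω → ℝ} (x : ℝ) :
    0 ≤ tail P Y x :=
  measureReal_nonneg

/-! ### Regularly varying tails and Karamata bounds for truncated moments -/

section Tail

variable {Ω : Type*} [MeasurableSpace Ω] {P : Measure Ω} [IsProbabilityMeasure P]
  {Y : Ω → ℝ} {β : ℝ}

lemma tail_antitone : Antitone (tail P Y) := fun _ _ h =>
  measureReal_mono fun _ hω => lt_of_le_of_lt h hω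

/-- A zero of the tail persists to its right, where the quotient `0 / 0` is `0` in Lean; regular
variation at `c = 1` demands the limit `1`. -/
lemma tail_pos (hrv : RegularlyVarying (tail P Y) β) (x : ℝ) : 0 < tail P Y x := by
  refine lt_of_le_of_ne (tail_nonneg x) fun h => ?_
  have h1 : Tendsto (fun y => tail P Y (1 * y) / tail P Y y) atTop (𝓝 0) := by
    refine tendsto_const_nhds.congr' ?_
    filter_upwards [eventually_ge_atTop x] with y hy
    have : tail P Y y = 0 := le_antisymm (h ▸ tail_antitone hy) (tail_nonneg y)
    simp [this]
  have h2 := tendsto_nhds_unique h1 (hrv 1 one_pos)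
  simp at h2

lemma tendsto_tail_atTop (hY : Measurable Y) : Tendsto (tail P Y) atTop (𝓝 0) := by
  have : IsProbabilityMeasure (P.map Y) := Measure.isProbabilityMeasure_map hY.aemeasurable
  have h := (tendsto_const_nhds (x := (1 : ℝ))).sub (tendsto_cdf_atTop (P.map Y))
  rw [sub_self] at h
  refine h.congr fun x => ?_
  have h1 : {ω | x < Y ω} = (Y ⁻¹' Set.Iic x)ᶜ := by ext; simp
  rw [cdf_eq_real, map_measureReal_apply hY measurableSet_Iic, tail, h1,
    probReal_compl_eq_one_sub (hY measurableSet_Iic)]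

/-- Regular variation bounds the tail at `c * x` by any multiple larger than `c ^ (-β)`. -/
lemma eventually_tail_mul_le (hrv : RegularlyVarying (tail P Y) β) {c r : ℝ} (hc : 0 < c)
    (hr : c ^ (-β) < r) : ∀ᶠ x in atTop, tail P Y (c * x) ≤ r * tail P Y x := by
  filter_upwards [(hrv c hc).eventually_lt_const hr] with x hx
  exact ((div_lt_iff₀ (tail_pos hrv x)).1 hx).le

lemma eventually_le_tail_mul (hrv : RegularlyVarying (tail P Y) β) {c r : ℝ} (hc : 0 < c)
    (hr : r < c ^ (-β)) : ∀ᶠ x in atTop, r * tail P Y x ≤ tail P Y (c * x) := by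
  filter_upwards [(hrv c hc).eventually_const_lt hr] with x hx
  exact ((lt_div_iff₀ (tail_pos hrv x)).1 hx).le

/-- Truncation of a real number to `[0, c]`: values outside of this interval are replaced by `0`. -/
noncomputable def trunc (c y : ℝ) : ℝ := (Set.Icc 0 c).indicator id y

lemma trunc_of_mem {c y : ℝ} (h0 : 0 ≤ y) (hc : y ≤ c) : trunc c y = y :=
  Set.indicator_of_mem (Set.mem_Icc.2 ⟨h0, hc⟩) _

lemma trunc_of_lt {c y : ℝ} (hc : c < y) : trunc c y = 0 :=
  Set.indicator_of_notMem (fun h => absurd h.2 (not_le.2 hc)) _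

lemma trunc_nonneg (c y : ℝ) : 0 ≤ trunc c y :=
  Set.indicator_nonneg (fun _ h => h.1) y

lemma trunc_le {c : ℝ} (hc : 0 ≤ c) (y : ℝ) : trunc c y ≤ c :=
  Set.indicator_le' (fun _ h => h.2) (fun _ _ => hc) y

lemma trunc_le_self {y : ℝ} (hy : 0 ≤ y) (c : ℝ) : trunc c y ≤ y :=
  Set.indicator_le' (fun _ _ => le_rfl) (fun _ _ => hy) y

lemma measurable_trunc (c : ℝ) : Measurable (trunc c) :=
  measurable_id.indicator measurableSet_Icc

lemma memLp_trunc (hY : Measurable Y) {c : ℝ} (hc : 0 ≤ c) (p : ℝ≥0∞) :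
    MemLp (fun ω => trunc c (Y ω)) p P :=
  MemLp.of_bound ((measurable_trunc c).comp hY).aestronglyMeasurable c <| .of_forall fun ω => by
    rw [Real.norm_of_nonneg (trunc_nonneg _ _)]; exact trunc_le hc _

lemma integrable_trunc (hY : Measurable Y) {c : ℝ} (hc : 0 ≤ c) :
    Integrable (fun ω => trunc c (Y ω)) P :=
  (memLp_trunc hY hc 1).integrable le_rfl

lemma integrable_trunc_pow (hY : Measurable Y) {c : ℝ} (hc : 0 ≤ c) (p : ℕ) :
    Integrable (fun ω => trunc c (Y ω) ^ p) P :=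
  Integrable.of_bound (((measurable_trunc c).comp hY).pow_const p).aestronglyMeasurable (c ^ p) <|
    .of_forall fun ω => by
      rw [Real.norm_of_nonneg (pow_nonneg (trunc_nonneg _ _) p)]
      exact pow_le_pow_left₀ (trunc_nonneg _ _) (trunc_le hc _) p

lemma integral_trunc_pow_mono (hY : Measurable Y) {c d : ℝ} (hc : 0 ≤ c) (hcd : c ≤ d) (p : ℕ) :
    ∫ ω, trunc c (Y ω) ^ p ∂P ≤ ∫ ω, trunc d (Y ω) ^ p ∂P := by
  refine integral_mono (integrable_trunc_pow hY hc p) (integrable_trunc_pow hY (hc.trans hcd) p)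
    fun ω => pow_le_pow_left₀ (trunc_nonneg _ _) ?_ p
  by_cases h : Y ω ∈ Set.Icc 0 c
  · rw [trunc_of_mem h.1 h.2, trunc_of_mem h.1 (h.2.trans hcd)]
  · rw [trunc, Set.indicator_of_notMem h]; exact trunc_nonneg _ _

/-- The dyadic step of the Karamata bound: the two truncations agree off `{x / 2 < Y}`, and on that
event the larger one is at most `x`. -/
lemma integral_trunc_pow_le_half (hY : Measurable Y) {x : ℝ} (hx : 0 ≤ x) {p : ℕ} (hp : p ≠ 0) :
    ∫ ω, trunc x (Y ω) ^ p ∂P ≤ ∫ ω, trunc (x / 2) (Y ω) ^ p ∂P + x ^ p * tail P Y (x / 2) := by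
  have hm : MeasurableSet {ω | x / 2 < Y ω} := measurableSet_lt measurable_const hY
  have hi : Integrable ({ω | x / 2 < Y ω}.indicator fun _ => x ^ p) P :=
    (integrable_const _).indicator hm
  have h1 : ∫ ω, {ω | x / 2 < Y ω}.indicator (fun _ => x ^ p) ω ∂P = x ^ p * tail P Y (x / 2) := by
    rw [integral_indicator_const _ hm, smul_eq_mul, mul_comm, tail]
  rw [← h1, ← integral_add (integrable_trunc_pow hY (by positivity) p) hi]
  refine integral_mono (integrable_trunc_pow hY hx p)
    ((integrable_trunc_pow hY (by positivity) p).add hi) fun ω => ?_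
  by_cases h : x / 2 < Y ω
  · simp only [Set.indicator, Set.mem_ofPred_eq, h, if_true, trunc_of_lt h, zero_pow hp, zero_add]
    exact pow_le_pow_left₀ (trunc_nonneg _ _) (trunc_le hx _) p
  · simp only [Set.indicator, Set.mem_ofPred_eq, h, if_false, add_zero]
    rcases lt_or_ge (Y ω) 0 with h0 | h0
    · have : trunc x (Y ω) = 0 :=
        Set.indicator_of_notMem (fun h => absurd h.1 (not_le.2 h0)) _
      rw [this, zero_pow hp]
      exact pow_nonneg (trunc_nonneg _ _) p
    · rw [trunc_of_mem h0 (by linarith), trunc_of_mem h0 (by linarith)]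

/-- Upper Karamata bound for truncated moments of order larger than the tail index. -/
lemma exists_integral_trunc_pow_le (hY : Measurable Y) (hrv : RegularlyVarying (tail P Y) β)
    {p : ℕ} (hp : p ≠ 0) (hβp : β < p) :
    ∃ C x₀ : ℝ, 0 < C ∧ 0 < x₀ ∧
      ∀ x, x₀ ≤ x → ∫ ω, trunc x (Y ω) ^ p ∂P ≤ C * (x ^ p * tail P Y x) := by
  -- Halving the argument multiplies the tail by about `2 ^ β`, less than the gain `2 ^ p` from the
  -- power; `r` separates the two.
  obtain ⟨r, hr1, hr2⟩ : ∃ r : ℝ, (1 / 2 : ℝ) ^ (-β) < r ∧ r < 2 ^ p := by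
    apply exists_between
    rw [← Real.rpow_natCast, one_div, Real.inv_rpow (by norm_num), Real.rpow_neg (by norm_num),
      inv_inv]
    exact Real.rpow_lt_rpow_of_exponent_lt (by norm_num) hβp
  have hr0 : 0 < r := lt_trans (by positivity) hr1
  obtain ⟨x₁, hx₁⟩ := eventually_atTop.1 (eventually_tail_mul_le hrv (by norm_num) hr1)
  set x₀ := max x₁ 1
  have hx₀ : 0 < x₀ := lt_of_lt_of_le one_pos (le_max_right _ _)
  have h2p : (0 : ℝ) < 2 ^ p := by positivity
  -- `A` covers the first scale `[x₀, 2 * x₀]`; `B` is the fixed point of `C ↦ C * (r / 2 ^ p) + r`,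
  -- so every `C ≥ B` survives the dyadic recursion.
  set A := (∫ ω, trunc (2 * x₀) (Y ω) ^ p ∂P) / (x₀ ^ p * tail P Y (2 * x₀))
  set B := r / (1 - r / 2 ^ p)
  have hθ : 0 < 1 - r / 2 ^ p := by rw [sub_pos, div_lt_one h2p]; exact hr2
  have hB : 0 < B := div_pos hr0 hθ
  set C := max A B
  have hC : 0 < C := lt_of_lt_of_le hB (le_max_right _ _)
  refine ⟨C, x₀, hC, hx₀, ?_⟩
  have key : ∀ k : ℕ, ∀ x, x₀ ≤ x → x ≤ 2 ^ (k + 1) * x₀ →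
      ∫ ω, trunc x (Y ω) ^ p ∂P ≤ C * (x ^ p * tail P Y x) := by
    intro k
    induction k with
    | zero =>
      intro x hx hx2
      have hd : 0 < x₀ ^ p * tail P Y (2 * x₀) := mul_pos (by positivity) (tail_pos hrv _)
      have hx2' : x ≤ 2 * x₀ := by simpa using hx2
      calc ∫ ω, trunc x (Y ω) ^ p ∂P ≤ ∫ ω, trunc (2 * x₀) (Y ω) ^ p ∂P :=
            integral_trunc_pow_mono hY (hx₀.le.trans hx) hx2' p
        _ = A * (x₀ ^ p * tail P Y (2 * x₀)) := (div_mul_cancel₀ _ hd.ne').symm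
        _ ≤ C * (x ^ p * tail P Y x) := by
            refine mul_le_mul (le_max_left _ _) ?_ hd.le hC.le
            exact mul_le_mul (pow_le_pow_left₀ hx₀.le hx p) (tail_antitone hx2') (tail_nonneg _)
              (pow_nonneg (hx₀.le.trans hx) p)
    | succ k ih =>
      intro x hx hx2
      have hx0 : 0 ≤ x := hx₀.le.trans hx
      by_cases hxs : x ≤ 2 * x₀
      · refine ih x hx (hxs.trans ?_)
        gcongr
        exact le_self_pow₀ (by norm_num) (by omega)
      · have h1 := ih (x / 2) (by linarith) (by rw [pow_succ] at hx2; linarith)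
        have h2 := integral_trunc_pow_le_half (P := P) hY hx0 hp
        have h3 := hx₁ x ((le_max_left _ _).trans hx)
        rw [show (1 / 2 : ℝ) * x = x / 2 by ring] at h3
        have hCB : C * (r / 2 ^ p) + r ≤ C := by
          have : r ≤ C * (1 - r / 2 ^ p) := (div_le_iff₀ hθ).1 (le_max_right A B)
          linarith
        calc ∫ ω, trunc x (Y ω) ^ p ∂P
            ≤ C * ((x / 2) ^ p * tail P Y (x / 2)) + x ^ p * tail P Y (x / 2) := by linarith
          _ = (C / 2 ^ p + 1) * x ^ p * tail P Y (x / 2) := by rw [div_pow]; ring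
          _ ≤ (C / 2 ^ p + 1) * x ^ p * (r * tail P Y x) := by gcongr
          _ = (C * (r / 2 ^ p) + r) * (x ^ p * tail P Y x) := by ring
          _ ≤ C * (x ^ p * tail P Y x) := by
            gcongr
            exact mul_nonneg (pow_nonneg hx0 p) (tail_nonneg _)
  intro x hx
  obtain ⟨k, hk⟩ := pow_unbounded_of_one_lt (x / x₀) (one_lt_two (α := ℝ))
  refine key k x hx ?_
  rw [div_lt_iff₀ hx₀] at hk
  refine hk.le.trans ?_
  gcongr
  · norm_num
  · omega

/-- Truncating at a small multiple of `x` makes the moments of order larger than the tail index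
small in comparison with `x ^ p * tail P Y x`. -/
lemma exists_integral_trunc_pow_le_mul (hY : Measurable Y) (hrv : RegularlyVarying (tail P Y) β)
    {p : ℕ} (hp : p ≠ 0) (hβp : β < p) {ε : ℝ} (hε : 0 < ε) :
    ∃ η : ℝ, 0 < η ∧ η < 1 ∧ ∀ᶠ x in atTop,
      ∫ ω, trunc (η * x) (Y ω) ^ p ∂P ≤ ε * (x ^ p * tail P Y x) := by
  obtain ⟨C, x₀, hC, hx₀, h⟩ := exists_integral_trunc_pow_le hY hrv hp hβp
  -- The Karamata bound at `η * x`, followed by `tail (η * x) ≤ 2 * η ^ (-β) * tail x`, produces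
  -- exactly this factor, which vanishes with `η` because `β < p`.
  have hlim : Tendsto (fun η : ℝ => C * 2 * η ^ ((p : ℝ) - β)) (𝓝[>] 0) (𝓝 0) := by
    have h1 : Tendsto (fun η : ℝ => η ^ ((p : ℝ) - β)) (𝓝 0) (𝓝 0) := by
      have h2 := Real.continuousAt_rpow_const 0 ((p : ℝ) - β) (.inr (by linarith))
      rwa [ContinuousAt, Real.zero_rpow (by linarith)] at h2
    simpa using (h1.mono_left nhdsWithin_le_nhds).const_mul (C * 2)
  obtain ⟨η, hηε, hη0, hη1⟩ := ((hlim.eventually_lt_const hε).and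
    (Ioo_mem_nhdsGT (one_pos (α := ℝ)))).exists
  refine ⟨η, hη0, hη1, ?_⟩
  have hη : 0 < η ^ (-β) := Real.rpow_pos_of_pos hη0 _
  filter_upwards [eventually_tail_mul_le hrv hη0 (r := 2 * η ^ (-β)) (by linarith),
    eventually_ge_atTop (x₀ / η), eventually_ge_atTop 0] with x h1 h2 h3
  calc ∫ ω, trunc (η * x) (Y ω) ^ p ∂P ≤ C * ((η * x) ^ p * tail P Y (η * x)) :=
        h _ ((div_le_iff₀' hη0).1 h2)
    _ ≤ C * ((η * x) ^ p * (2 * η ^ (-β) * tail P Y x)) := by gcongr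
    _ = C * 2 * η ^ ((p : ℝ) - β) * (x ^ p * tail P Y x) := by
        rw [sub_eq_add_neg, Real.rpow_add hη0, Real.rpow_natCast, mul_pow]; ring
    _ ≤ ε * (x ^ p * tail P Y x) := by
        gcongr
        exact mul_nonneg (pow_nonneg h3 p) (tail_nonneg _)

/-- Karamata's bound for the mean excess, as a lower integral. -/
lemma exists_lintegral_excess_le (hY : Measurable Y) (hrv : RegularlyVarying (tail P Y) β)
    (hβ : 1 < β) : ∃ C x₀ : ℝ, 0 < C ∧ 0 < x₀ ∧ ∀ x, x₀ ≤ x →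
      ∫⁻ ω in {ω | x < Y ω}, ENNReal.ofReal (Y ω) ∂P ≤ ENNReal.ofReal (C * (x * tail P Y x)) := by
  -- With `r < 1 / 2`, the dyadic shell at height `2 ^ k * x` contributes at most a multiple of `(2
  -- * r) ^ k`, a convergent geometric series.
  obtain ⟨r, hr1, hr2⟩ : ∃ r : ℝ, (2 : ℝ) ^ (-β) < r ∧ r < 1 / 2 := by
    apply exists_between
    calc (2 : ℝ) ^ (-β) < 2 ^ (-1 : ℝ) :=
          Real.rpow_lt_rpow_of_exponent_lt (by norm_num) (by linarith)
      _ = 1 / 2 := by rw [Real.rpow_neg_one]; norm_num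
  have hr0 : 0 < r := lt_trans (by positivity) hr1
  obtain ⟨x₁, hx₁⟩ := eventually_atTop.1 (eventually_tail_mul_le hrv (by norm_num) hr1)
  refine ⟨2 * (1 - 2 * r)⁻¹, max x₁ 1, mul_pos two_pos (inv_pos.2 (by linarith)),
    lt_of_lt_of_le one_pos (le_max_right _ _), fun x hx => ?_⟩
  have hx1 : x₁ ≤ x := (le_max_left _ _).trans hx
  have hx0 : 0 < x := lt_of_lt_of_le one_pos ((le_max_right _ _).trans hx)
  have hF : ∀ k : ℕ, tail P Y (2 ^ k * x) ≤ r ^ k * tail P Y x := by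
    intro k
    induction k with
    | zero => simp
    | succ k ih =>
      have h1 : x₁ ≤ 2 ^ k * x := hx1.trans (le_mul_of_one_le_left hx0.le (one_le_pow₀ one_le_two))
      calc tail P Y (2 ^ (k + 1) * x) = tail P Y (2 * (2 ^ k * x)) := by ring_nf
        _ ≤ r * tail P Y (2 ^ k * x) := hx₁ _ h1
        _ ≤ r * (r ^ k * tail P Y x) := by gcongr
        _ = r ^ (k + 1) * tail P Y x := by ring
  have hm : ∀ u : ℝ, MeasurableSet {ω | u < Y ω} := fun u => measurableSet_lt measurable_const hY
  have hpt : ∀ ω, {ω | x < Y ω}.indicator (fun ω => ENNReal.ofReal (Y ω)) ω ≤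
      ∑' k : ℕ, {ω | 2 ^ k * x < Y ω}.indicator
        (fun _ => ENNReal.ofReal (2 ^ (k + 1) * x)) ω := by
    intro ω
    by_cases hω : x < Y ω
    · obtain ⟨k, hk1, hk2⟩ := exists_nat_pow_near (x := Y ω / x) (y := (2 : ℝ))
        ((one_le_div hx0).2 hω.le) one_lt_two
      rw [le_div_iff₀ hx0] at hk1
      rw [div_lt_iff₀ hx0] at hk2
      rw [Set.indicator_of_mem (by exact hω)]
      rcases hk1.lt_or_eq with hk1 | hk1
      · refine le_trans ?_ (ENNReal.le_tsum k)
        rw [Set.indicator_of_mem (by exact hk1)]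
        exact ENNReal.ofReal_le_ofReal hk2.le
      -- When `Y ω` equals `2 ^ k * x`, the strict event of index `k` fails, so the preceding shell
      -- is used; `k = 0` is excluded by `x < Y ω`.
      · cases k with
        | zero => simp at hk1; linarith
        | succ k =>
          refine le_trans ?_ (ENNReal.le_tsum k)
          rw [Set.indicator_of_mem]
          · exact ENNReal.ofReal_le_ofReal hk1.ge
          · rw [Set.mem_ofPred_eq, ← hk1]
            gcongr
            · norm_num
            · omega
    · rw [Set.indicator_of_notMem (by exact hω)]; exact zero_le
  rw [← lintegral_indicator (hm x)]
  have hsum : HasSum (fun k : ℕ => 2 * x * tail P Y x * (2 * r) ^ k)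
      (2 * x * tail P Y x * (1 - 2 * r)⁻¹) :=
    (hasSum_geometric_of_lt_one (by linarith) (by linarith)).mul_left _
  have hnn : ∀ k : ℕ, 0 ≤ 2 * x * tail P Y x * (2 * r) ^ k := fun k =>
    mul_nonneg (mul_nonneg (by linarith) (tail_nonneg _)) (by positivity)
  calc ∫⁻ ω, {ω | x < Y ω}.indicator (fun ω => ENNReal.ofReal (Y ω)) ω ∂P
      ≤ ∫⁻ ω, ∑' k : ℕ, {ω | 2 ^ k * x < Y ω}.indicator
        (fun _ => ENNReal.ofReal (2 ^ (k + 1) * x)) ω ∂P := lintegral_mono hpt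
    _ = ∑' k : ℕ, ENNReal.ofReal (2 ^ (k + 1) * x) * P {ω | 2 ^ k * x < Y ω} := by
        rw [lintegral_tsum fun k => (measurable_const.indicator (hm _)).aemeasurable]
        exact tsum_congr fun k => lintegral_indicator_const (hm _) _
    _ ≤ ∑' k : ℕ, ENNReal.ofReal (2 * x * tail P Y x * (2 * r) ^ k) := by
        refine ENNReal.tsum_le_tsum fun k => ?_
        rw [← ofReal_measureReal, ← ENNReal.ofReal_mul (by positivity)]
        apply ENNReal.ofReal_le_ofReal
        calc 2 ^ (k + 1) * x * tail P Y (2 ^ k * x)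
            ≤ 2 ^ (k + 1) * x * (r ^ k * tail P Y x) := by gcongr; exact hF k
          _ = _ := by rw [mul_pow]; ring
    _ = ENNReal.ofReal (2 * (1 - 2 * r)⁻¹ * (x * tail P Y x)) := by
        rw [← ENNReal.ofReal_tsum_of_nonneg hnn hsum.summable, hsum.tsum_eq]
        congr 1; ring

lemma integrable_of_regularlyVarying (hY : Measurable Y) (hY0 : ∀ᵐ ω ∂P, 0 ≤ Y ω)
    (hrv : RegularlyVarying (tail P Y) β) (hβ : 1 < β) : Integrable Y P := by
  obtain ⟨C, x₀, hC, hx₀, h⟩ := exists_lintegral_excess_le hY hrv hβ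
  have hm : MeasurableSet {ω | x₀ < Y ω} := measurableSet_lt measurable_const hY
  refine ⟨hY.aestronglyMeasurable, ?_⟩
  rw [hasFiniteIntegral_iff_ofReal hY0, ← lintegral_add_compl _ hm]
  refine ENNReal.add_lt_top.2 ⟨(h x₀ le_rfl).trans_lt ENNReal.ofReal_lt_top, ?_⟩
  refine lt_of_le_of_lt (setLIntegral_mono (g := fun _ => ENNReal.ofReal x₀) measurable_const
    fun ω hω => ENNReal.ofReal_le_ofReal (not_lt.1 hω)) ?_
  rw [setLIntegral_const]
  exact ENNReal.mul_lt_top ENNReal.ofReal_lt_top (measure_lt_top _ _)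

/-- The loss of mean caused by truncation at `x` is of order `x * tail P Y x`. -/
lemma exists_integral_sub_trunc_le (hY : Measurable Y) (hY0 : ∀ᵐ ω ∂P, 0 ≤ Y ω)
    (hrv : RegularlyVarying (tail P Y) β) (hβ : 1 < β) : ∃ C x₀ : ℝ, 0 < C ∧ 0 < x₀ ∧
      ∀ x, x₀ ≤ x → ∫ ω, Y ω ∂P - ∫ ω, trunc x (Y ω) ∂P ≤ C * (x * tail P Y x) := by
  obtain ⟨C, x₀, hC, hx₀, h⟩ := exists_lintegral_excess_le hY hrv hβ
  refine ⟨C, x₀, hC, hx₀, fun x hx => ?_⟩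
  have hm : MeasurableSet {ω | x < Y ω} := measurableSet_lt measurable_const hY
  have hx0 : 0 ≤ x := hx₀.le.trans hx
  have hYi := integrable_of_regularlyVarying hY hY0 hrv hβ
  rw [← integral_sub hYi (integrable_trunc hY hx0)]
  have h1 : ∫ ω, (Y ω - trunc x (Y ω)) ∂P = ∫ ω in {ω | x < Y ω}, Y ω ∂P := by
    rw [← integral_indicator hm]
    refine integral_congr_ae ?_
    filter_upwards [hY0] with ω hω
    by_cases hxω : x < Y ω
    · rw [Set.indicator_of_mem (by exact hxω), trunc_of_lt hxω, sub_zero]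
    · rw [Set.indicator_of_notMem (by exact hxω), trunc_of_mem hω (not_lt.1 hxω), sub_self]
  rw [h1, integral_eq_lintegral_of_nonneg_ae (ae_restrict_of_ae hY0) hY.aestronglyMeasurable]
  exact ENNReal.toReal_le_of_le_ofReal (by have := tail_nonneg (P := P) (Y := Y) x; positivity)
    (h x hx)

end Tail

/-! ### The single big jump for a fixed number of summands -/

section BigJump

variable {Ω : Type*} [MeasurableSpace Ω] {P : Measure Ω} {X : ℕ → Ω → ℝ} {β : ℝ}

lemma measureReal_lt_eq_tail (hXident : ∀ k, IdentDistrib (X k) (X 0) P P) (k : ℕ) (u : ℝ) :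
    P.real {ω | u < X k ω} = tail P (X 0) u :=
  congrArg ENNReal.toReal ((hXident k).measure_mem_eq measurableSet_Ioi)

lemma identDistrib_trunc (hXident : ∀ k, IdentDistrib (X k) (X 0) P P) (c : ℝ) (k : ℕ) :
    IdentDistrib (fun ω => trunc c (X k ω)) (fun ω => trunc c (X 0 ω)) P P :=
  (hXident k).comp (measurable_trunc c)

lemma measureReal_lt_and_lt (hXident : ∀ k, IdentDistrib (X k) (X 0) P P)
    (hpair : Pairwise fun i j => IndepFun (X i) (X j) P) {i j : ℕ} (hij : i ≠ j) (u : ℝ) :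
    P.real {ω | u < X i ω ∧ u < X j ω} = tail P (X 0) u ^ 2 := by
  have h := (hpair hij).measure_inter_preimage_eq_mul (Set.Ioi u) (Set.Ioi u) measurableSet_Ioi
    measurableSet_Ioi
  have h' := congrArg ENNReal.toReal h
  rw [ENNReal.toReal_mul] at h'
  rw [sq]
  nth_rewrite 1 [← measureReal_lt_eq_tail hXident i u]
  rw [← measureReal_lt_eq_tail hXident j u]
  exact h'

lemma measureReal_exists_lt_le (hXident : ∀ k, IdentDistrib (X k) (X 0) P P) (n : ℕ) (u : ℝ) :
    P.real {ω | ∃ i ∈ Finset.range n, u < X i ω} ≤ n * tail P (X 0) u := by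
  have h : {ω | ∃ i ∈ Finset.range n, u < X i ω} = ⋃ i ∈ Finset.range n, {ω | u < X i ω} := by
    ext ω; simp
  rw [h]
  refine (measureReal_biUnion_finset_le _ _).trans ?_
  simp [measureReal_lt_eq_tail hXident]

lemma measureReal_exists_pair_le (hXident : ∀ k, IdentDistrib (X k) (X 0) P P)
    (hpair : Pairwise fun i j => IndepFun (X i) (X j) P) (n : ℕ) (u : ℝ) :
    P.real {ω | ∃ i ∈ Finset.range n, ∃ j ∈ Finset.range n, i ≠ j ∧ u < X i ω ∧ u < X j ω} ≤
      (n * tail P (X 0) u) ^ 2 := by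
  have h : {ω | ∃ i ∈ Finset.range n, ∃ j ∈ Finset.range n, i ≠ j ∧ u < X i ω ∧ u < X j ω} =
      ⋃ i ∈ Finset.range n, ⋃ j ∈ Finset.range n, {ω | i ≠ j ∧ u < X i ω ∧ u < X j ω} := by
    ext ω; simp only [Set.mem_iUnion, Set.mem_ofPred_eq, exists_prop]
  rw [h]
  calc _ ≤ ∑ i ∈ Finset.range n, P.real
          (⋃ j ∈ Finset.range n, {ω | i ≠ j ∧ u < X i ω ∧ u < X j ω}) :=
        measureReal_biUnion_finset_le _ _
    _ ≤ ∑ i ∈ Finset.range n, ∑ j ∈ Finset.range n, P.real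
          {ω | i ≠ j ∧ u < X i ω ∧ u < X j ω} :=
        Finset.sum_le_sum fun i _ => measureReal_biUnion_finset_le _ _
    _ ≤ ∑ i ∈ Finset.range n, ∑ j ∈ Finset.range n, tail P (X 0) u ^ 2 := by
        refine Finset.sum_le_sum fun i _ => Finset.sum_le_sum fun j _ => ?_
        by_cases hij : i = j
        · simp [hij, sq_nonneg]
        · simp [hij, measureReal_lt_and_lt hXident hpair hij]
    _ = (n * tail P (X 0) u) ^ 2 := by simp; ring

variable [IsProbabilityMeasure P]

/-- Bonferroni's inequality for the maximum of pairwise independent variables. -/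
lemma le_measureReal_exists_lt (hXm : ∀ k, Measurable (X k))
    (hXident : ∀ k, IdentDistrib (X k) (X 0) P P)
    (hpair : Pairwise fun i j => IndepFun (X i) (X j) P) (n : ℕ) (u : ℝ) :
    n * tail P (X 0) u - (n * tail P (X 0) u) ^ 2 ≤
      P.real {ω | ∃ i ∈ Finset.range n, u < X i ω} := by
  induction n with
  | zero => simp
  | succ n ih =>
    set A := {ω | ∃ i ∈ Finset.range n, u < X i ω}
    have hB : MeasurableSet {ω | u < X n ω} := measurableSet_lt measurable_const (hXm n)
    have h1 : {ω | ∃ i ∈ Finset.range (n + 1), u < X i ω} = A ∪ {ω | u < X n ω} := by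
      ext ω
      simp [A, Finset.range_add_one, or_comm]
    have h2 := measureReal_union_add_inter (μ := P) (s := A) hB
    have h3 : P.real (A ∩ {ω | u < X n ω}) ≤ n * tail P (X 0) u ^ 2 := by
      have h : A ∩ {ω | u < X n ω} = ⋃ i ∈ Finset.range n, {ω | u < X i ω ∧ u < X n ω} := by
        ext ω
        simp only [A, Set.mem_inter_iff, Set.mem_iUnion, Set.mem_ofPred_eq, exists_prop]
        exact ⟨fun ⟨⟨i, hi, h⟩, h'⟩ => ⟨i, hi, h, h'⟩, fun ⟨i, hi, h, h'⟩ => ⟨⟨i, hi, h⟩, h'⟩⟩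
      rw [h]
      refine (measureReal_biUnion_finset_le _ _).trans ?_
      rw [Finset.sum_congr rfl fun i hi =>
        measureReal_lt_and_lt hXident hpair (Finset.mem_range.1 hi).ne u]
      simp
    rw [h1]
    rw [measureReal_lt_eq_tail hXident] at h2
    push_cast
    have h4 : 0 ≤ (n : ℝ) * tail P (X 0) u ^ 2 := by positivity
    -- The new event overlaps the old union by at most `n * F ^ 2`, and `n ^ 2 + n ≤ (n + 1) ^ 2`.
    nlinarith [sq_nonneg (tail P (X 0) u)]

/-- The truncated sums, centered by `n * m`, deviate by `δ * x` with probability small in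
comparison with `n * P[X > x]`, when truncation takes place at a small multiple `η * x` of `x`. -/
def TruncatedSumsConcentrate (P : Measure Ω) (X : ℕ → Ω → ℝ) (m : ℝ) : Prop :=
  ∀ δ > 0, ∀ ε > 0, ∃ η : ℝ, 0 < η ∧ η < 1 ∧ ∃ κ > 0, ∀ᶠ x in atTop, ∀ n : ℕ,
    P.real {ω | δ * x < ∑ i ∈ Finset.range n, trunc (η * x) (X i ω) - n * m} ≤
      ε * (n * tail P (X 0) x) ∧
    (n * tail P (X 0) x ≤ κ →
      P.real {ω | ∑ i ∈ Finset.range n, trunc (η * x) (X i ω) - n * m ≤ -(δ * x)} ≤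
        ε * (n * tail P (X 0) x))

lemma integral_sum_trunc (hXm : ∀ k, Measurable (X k))
    (hXident : ∀ k, IdentDistrib (X k) (X 0) P P) {c : ℝ} (hc : 0 ≤ c) (n : ℕ) :
    ∫ ω, ∑ i ∈ Finset.range n, trunc c (X i ω) ∂P = n * ∫ ω, trunc c (X 0 ω) ∂P := by
  rw [integral_finsetSum _ fun i _ => integrable_trunc (hXm i) hc]
  simp [fun i => (identDistrib_trunc hXident c i).integral_eq]

/-- For `β < 1` the first truncated moment is already of order `x * tail x`, so Markov's inequality
suffices. Truncated sums are nonnegative, so the downward deviation is impossible for `x > 0`. -/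
lemma truncatedSumsConcentrate_of_lt_one (hXm : ∀ k, Measurable (X k))
    (hXident : ∀ k, IdentDistrib (X k) (X 0) P P)
    (hXrv : RegularlyVarying (tail P (X 0)) β) (hβ : β < 1) :
    TruncatedSumsConcentrate P X 0 := by
  intro δ hδ ε hε
  obtain ⟨η, hη0, hη1, h⟩ := exists_integral_trunc_pow_le_mul (p := 1) (hXm 0) hXrv one_ne_zero
    (by simpa using hβ) (mul_pos hε hδ)
  refine ⟨η, hη0, hη1, 1, one_pos, ?_⟩
  filter_upwards [h, eventually_gt_atTop 0] with x hx hx0 n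
  simp only [pow_one] at hx
  have hnn : ∀ ω, 0 ≤ ∑ i ∈ Finset.range n, trunc (η * x) (X i ω) := fun ω =>
    Finset.sum_nonneg fun i _ => trunc_nonneg _ _
  have hRHS : 0 ≤ ε * (n * tail P (X 0) x) := by
    have := tail_nonneg (P := P) (Y := X 0) x; positivity
  constructor
  · have h1 := mul_meas_ge_le_integral_of_nonneg (μ := P) (ae_of_all _ hnn)
      (integrable_finsetSum _ fun i _ => integrable_trunc (hXm i) (by positivity)) (δ * x)
    rw [integral_sum_trunc hXm hXident (by positivity)] at h1
    have h2 : P.real {ω | δ * x < ∑ i ∈ Finset.range n, trunc (η * x) (X i ω) - n * 0} ≤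
        P.real {ω | δ * x ≤ ∑ i ∈ Finset.range n, trunc (η * x) (X i ω)} :=
      measureReal_mono fun ω hω => by
        simp only [mul_zero, sub_zero, Set.mem_ofPred_eq] at hω ⊢; exact hω.le
    refine h2.trans (le_of_mul_le_mul_left (h1.trans ?_) (mul_pos hδ hx0))
    calc n * ∫ ω, trunc (η * x) (X 0 ω) ∂P ≤ n * (ε * δ * (x * tail P (X 0) x)) := by gcongr
      _ = _ := by ring
  · intro _
    convert hRHS
    rw [measureReal_eq_zero_iff]
    convert measure_empty (μ := P)
    ext ω
    simp only [mul_zero, sub_zero, Set.mem_ofPred_eq, Set.mem_empty_iff_false, iff_false, not_le]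
    exact lt_of_lt_of_le (by nlinarith) (hnn ω)

/-- Chebyshev's inequality: pairwise independence makes variances add, and each variance is at most
the second moment. -/
lemma measureReal_sum_trunc_deviation_le (hXm : ∀ k, Measurable (X k))
    (hXident : ∀ k, IdentDistrib (X k) (X 0) P P)
    (hpair : Pairwise fun i j => IndepFun (X i) (X j) P) {c d : ℝ} (hc : 0 ≤ c) (hd : 0 < d)
    (n : ℕ) :
    P.real {ω | d ≤ |∑ i ∈ Finset.range n, trunc c (X i ω) - n * ∫ ω, trunc c (X 0 ω) ∂P|} ≤
      n * (∫ ω, trunc c (X 0 ω) ^ 2 ∂P) / d ^ 2 := by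
  have hL : ∀ i, MemLp (fun ω => trunc c (X i ω)) 2 P := fun i => memLp_trunc (hXm i) hc 2
  have hvar : variance (∑ i ∈ Finset.range n, fun ω => trunc c (X i ω)) P ≤
      n * ∫ ω, trunc c (X 0 ω) ^ 2 ∂P := by
    rw [IndepFun.variance_sum (fun i _ => hL i) fun i _ j _ hij =>
      (hpair hij).comp (measurable_trunc c) (measurable_trunc c)]
    calc _ ≤ ∑ i ∈ Finset.range n, ∫ ω, trunc c (X 0 ω) ^ 2 ∂P := by
          refine Finset.sum_le_sum fun i _ => ?_
          rw [(identDistrib_trunc hXident c i).variance_eq]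
          exact variance_le_expectation_sq (hL 0).aestronglyMeasurable
      _ = _ := by simp
  have hcheb := meas_ge_le_variance_div_sq (memLp_finsetSum' (Finset.range n) fun i _ => hL i) hd
  have hE : ∫ ω, (∑ i ∈ Finset.range n, fun ω => trunc c (X i ω)) ω ∂P =
      n * ∫ ω, trunc c (X 0 ω) ∂P := by
    rw [← integral_sum_trunc hXm hXident hc]
    simp only [Finset.sum_apply]
  rw [hE] at hcheb
  simp only [Finset.sum_apply] at hcheb
  refine (ENNReal.toReal_le_of_le_ofReal
    (div_nonneg (variance_nonneg _ _) (sq_nonneg d)) hcheb).trans ?_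
  gcongr

/-- For `1 < β < 2` Chebyshev's inequality controls fluctuations about the truncated mean `m'`. The
remaining issue is the bias `n * (m - m')`, which only hurts downward deviations. -/
lemma truncatedSumsConcentrate_of_one_lt (hXm : ∀ k, Measurable (X k))
    (hXident : ∀ k, IdentDistrib (X k) (X 0) P P)
    (hpair : Pairwise fun i j => IndepFun (X i) (X j) P)
    (hX0 : ∀ᵐ ω ∂P, 0 ≤ X 0 ω)
    (hXrv : RegularlyVarying (tail P (X 0)) β) (hβ : 1 < β) (hβ2 : β < 2) :
    TruncatedSumsConcentrate P X (∫ ω, X 0 ω ∂P) := by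
  intro δ hδ ε hε
  obtain ⟨η, hη0, hη1, h⟩ := exists_integral_trunc_pow_le_mul (p := 2) (hXm 0) hXrv two_ne_zero
    (by simpa using hβ2) (ε := ε * (δ / 2) ^ 2) (by positivity)
  obtain ⟨C, x₀, hC, hx₀, hmean⟩ := exists_integral_sub_trunc_le (hXm 0) hX0 hXrv hβ
  have hηβ : 0 < η ^ (-β) := Real.rpow_pos_of_pos hη0 _
  -- This `κ` makes the bias `n * (m - m')` at most `δ / 2 * x`, leaving the other half of `δ * x`
  -- for the fluctuation.
  refine ⟨η, hη0, hη1, δ / 2 / (C * η * (2 * η ^ (-β))), by positivity, ?_⟩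
  filter_upwards [h, eventually_gt_atTop 0, eventually_ge_atTop (x₀ / η),
    eventually_tail_mul_le hXrv hη0 (r := 2 * η ^ (-β)) (by linarith)] with x hx hx0 hxx hF n
  have hc : 0 ≤ η * x := by positivity
  have hm1 : ∫ ω, trunc (η * x) (X 0 ω) ∂P ≤ ∫ ω, X 0 ω ∂P := by
    refine integral_mono_ae (integrable_trunc (hXm 0) hc)
      (integrable_of_regularlyVarying (hXm 0) hX0 hXrv hβ) ?_
    filter_upwards [hX0] with ω hω using trunc_le_self hω _
  have hm2 := hmean (η * x) ((div_le_iff₀' hη0).1 hxx)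
  set m := ∫ ω, X 0 ω ∂P
  set m' := ∫ ω, trunc (η * x) (X 0 ω) ∂P
  have hdev : P.real {ω | δ / 2 * x ≤
      |∑ i ∈ Finset.range n, trunc (η * x) (X i ω) - n * m'|} ≤ ε * (n * tail P (X 0) x) := by
    refine (measureReal_sum_trunc_deviation_le hXm hXident hpair hc (by positivity) n).trans ?_
    rw [div_le_iff₀ (by positivity)]
    calc n * ∫ ω, trunc (η * x) (X 0 ω) ^ 2 ∂P
        ≤ n * (ε * (δ / 2) ^ 2 * (x ^ 2 * tail P (X 0) x)) := by gcongr
      _ = _ := by ring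
  constructor
  · refine (measureReal_mono fun ω hω => ?_).trans hdev
    simp only [Set.mem_ofPred_eq] at hω ⊢
    -- Centering by the full mean subtracts more than centering by `m'`, so no restriction on `n` is
    -- needed here.
    have : (n : ℝ) * m' ≤ n * m := by gcongr
    refine le_trans ?_ (le_abs_self _)
    nlinarith
  · intro hn
    refine (measureReal_mono fun ω hω => ?_).trans hdev
    simp only [Set.mem_ofPred_eq] at hω ⊢
    have h1 : n * (m - m') ≤ δ / 2 * x := by
      calc n * (m - m') ≤ n * (C * (η * x * tail P (X 0) (η * x))) := by gcongr
        _ ≤ n * (C * (η * x * (2 * η ^ (-β) * tail P (X 0) x))) := by gcongr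
        _ = (n * tail P (X 0) x) * (C * η * (2 * η ^ (-β))) * x := by ring
        _ ≤ δ / 2 / (C * η * (2 * η ^ (-β))) * (C * η * (2 * η ^ (-β))) * x := by gcongr
        _ = δ / 2 * x := by field_simp
    refine le_trans ?_ (neg_le_abs _)
    nlinarith

/-- A large sum is due to one large summand, to two fairly large summands, or to a large sum
of truncated summands. -/
lemma exists_large_or_of_lt_sum {y : ℕ → ℝ} {n : ℕ} (hy : ∀ i ∈ Finset.range n, 0 ≤ y i)
    {δ x c m : ℝ} (hx : 0 ≤ x) (hδ : δ ≤ 1) (h : x < ∑ i ∈ Finset.range n, y i - m) :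
    (∃ i ∈ Finset.range n, (1 - δ) * x < y i) ∨
    (∃ i ∈ Finset.range n, ∃ j ∈ Finset.range n, i ≠ j ∧ c < y i ∧ c < y j) ∨
    δ * x < ∑ i ∈ Finset.range n, trunc c (y i) - m := by
  by_contra! hcon
  obtain ⟨h1, h2, h3⟩ := hcon
  by_cases hex : ∃ i ∈ Finset.range n, c < y i
  · obtain ⟨i, hi, hci⟩ := hex
    -- Here `i` is the only summand above `c`: truncation deletes it and leaves the others
    -- unchanged, so the total is at most `(1 - δ) * x + δ * x`.
    rw [← Finset.add_sum_erase _ _ hi] at h h3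
    have h4 : ∑ j ∈ (Finset.range n).erase i, trunc c (y j) =
        ∑ j ∈ (Finset.range n).erase i, y j :=
      Finset.sum_congr rfl fun j hj => trunc_of_mem (hy j (Finset.mem_of_mem_erase hj))
        (h2 i hi j (Finset.mem_of_mem_erase hj) (Finset.ne_of_mem_erase hj).symm hci)
    rw [h4, trunc_of_lt hci] at h3
    linarith [h1 i hi]
  · push Not at hex
    have h4 : ∑ j ∈ Finset.range n, trunc c (y j) = ∑ j ∈ Finset.range n, y j :=
      Finset.sum_congr rfl fun j hj => trunc_of_mem (hy j hj) (hex j hj)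
    rw [h4] at h3
    nlinarith

/-- A large summand produces a large sum, unless the sum of truncated summands is very small. -/
lemma lt_sum_or_of_exists_large {y : ℕ → ℝ} {n : ℕ} (hy : ∀ i ∈ Finset.range n, 0 ≤ y i)
    {δ x c m : ℝ} (hc : c ≤ (1 + δ) * x) (h : ∃ i ∈ Finset.range n, (1 + δ) * x < y i) :
    x < ∑ i ∈ Finset.range n, y i - m ∨
      ∑ i ∈ Finset.range n, trunc c (y i) - m ≤ -(δ * x) := by
  by_contra! hcon
  obtain ⟨h1, h2⟩ := hcon
  obtain ⟨i, hi, hxi⟩ := h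
  rw [← Finset.add_sum_erase _ _ hi] at h1 h2
  rw [trunc_of_lt (hc.trans_lt hxi)] at h2
  have h4 : ∑ j ∈ (Finset.range n).erase i, trunc c (y j) ≤
      ∑ j ∈ (Finset.range n).erase i, y j :=
    Finset.sum_le_sum fun j hj => trunc_le_self (hy j (Finset.mem_of_mem_erase hj)) _
  linarith

lemma measureReal_le_add_of_ae {p q r : Ω → Prop} (h : ∀ᵐ ω ∂P, p ω → q ω ∨ r ω) :
    P.real {ω | p ω} ≤ P.real {ω | q ω} + P.real {ω | r ω} := by
  refine le_trans (ENNReal.toReal_mono (measure_ne_top _ _) (measure_mono_ae ?_))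
    (measureReal_union_le {ω | q ω} {ω | r ω})
  filter_upwards [h] with ω hω using hω

/-- The tail of a centered sum of `n` summands is at most of order `n * P[X > x]`, uniformly
in `n`. -/
lemma exists_tail_sum_le (hXident : ∀ k, IdentDistrib (X k) (X 0) P P)
    (hX0 : ∀ k, ∀ᵐ ω ∂P, 0 ≤ X k ω) (hXrv : RegularlyVarying (tail P (X 0)) β) {m : ℝ}
    (hconc : TruncatedSumsConcentrate P X m) :
    ∃ C > 0, ∀ᶠ x in atTop, ∀ n : ℕ,
      P.real {ω | x < partialSum X n ω - n * m} ≤ C * (n * tail P (X 0) x) := by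
  obtain ⟨η, hη0, hη1, κ, -, h⟩ := hconc 1 one_pos 1 one_pos
  have hηβ : 0 < η ^ (-β) := Real.rpow_pos_of_pos hη0 _
  refine ⟨2 * η ^ (-β) + 1, by positivity, ?_⟩
  filter_upwards [h, eventually_tail_mul_le hXrv hη0 (r := 2 * η ^ (-β)) (by linarith)]
    with x hx hF n
  -- If no summand exceeds `η * x`, truncation changes nothing, so concentration with `δ = ε = 1`
  -- applies to the sum itself.
  have h1 : P.real {ω | x < partialSum X n ω - n * m} ≤
      P.real {ω | ∃ i ∈ Finset.range n, η * x < X i ω} +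
      P.real {ω | 1 * x < ∑ i ∈ Finset.range n, trunc (η * x) (X i ω) - n * m} := by
    apply measureReal_le_add_of_ae
    filter_upwards [ae_all_iff.2 hX0] with ω hω hlt
    by_contra! hcon
    obtain ⟨h2, h3⟩ := hcon
    have h4 : ∑ j ∈ Finset.range n, trunc (η * x) (X j ω) = ∑ j ∈ Finset.range n, X j ω :=
      Finset.sum_congr rfl fun j hj => trunc_of_mem (hω j) (h2 j hj)
    rw [h4, one_mul] at h3
    exact absurd hlt (not_lt.2 h3)
  refine h1.trans ((add_le_add (measureReal_exists_lt_le hXident n _) (hx n).1).trans ?_)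
  calc n * tail P (X 0) (η * x) + 1 * (n * tail P (X 0) x)
      ≤ n * (2 * η ^ (-β) * tail P (X 0) x) + 1 * (n * tail P (X 0) x) := by gcongr
    _ = _ := by ring

/-- The principle of a single big jump, uniformly where `n * P[X > x]` is small. -/
lemma exists_abs_tail_sum_sub_le (hXm : ∀ k, Measurable (X k))
    (hXident : ∀ k, IdentDistrib (X k) (X 0) P P)
    (hpair : Pairwise fun i j => IndepFun (X i) (X j) P)
    (hX0 : ∀ k, ∀ᵐ ω ∂P, 0 ≤ X k ω) (hXrv : RegularlyVarying (tail P (X 0)) β) {m : ℝ}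
    (hconc : TruncatedSumsConcentrate P X m) {ε : ℝ} (hε : 0 < ε) :
    ∃ κ > 0, ∀ᶠ x in atTop, ∀ n : ℕ, n * tail P (X 0) x ≤ κ →
      |P.real {ω | x < partialSum X n ω - n * m} - n * tail P (X 0) x| ≤
        ε * (n * tail P (X 0) x) := by
  -- The margin `δ` is fixed first, so that shifting the threshold to `(1 ± δ) * x` costs a relative
  -- error of at most `ε / 4`.
  obtain ⟨δ, hδup, hδlow, hδ0, hδ1⟩ : ∃ δ : ℝ, (1 - δ) ^ (-β) < 1 + ε / 4 ∧
      1 - ε / 4 < (1 + δ) ^ (-β) ∧ 0 < δ ∧ δ < 1 := by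
    have hc : ∀ σ : ℝ, Tendsto (fun δ : ℝ => (1 + σ * δ) ^ (-β)) (𝓝[>] 0) (𝓝 1) := by
      intro σ
      have h1 : ContinuousAt (fun δ : ℝ => (1 + σ * δ) ^ (-β)) 0 :=
        ContinuousAt.rpow_const (by fun_prop) (.inl (by simp))
      have h2 := h1.tendsto
      simp only [mul_zero, add_zero, Real.one_rpow] at h2
      exact h2.mono_left nhdsWithin_le_nhds
    obtain ⟨δ, h1, h2, h3⟩ := (((hc (-1)).eventually_lt_const (u := 1 + ε / 4) (by linarith)).and
      (((hc 1).eventually_const_lt (u := 1 - ε / 4) (by linarith)).and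
        (Ioo_mem_nhdsGT (one_pos (α := ℝ))))).exists
    refine ⟨δ, ?_, ?_, h3.1, h3.2⟩
    · simpa [← sub_eq_add_neg] using h1
    · simpa using h2
  obtain ⟨η, hη0, hη1, κ, hκ, h⟩ := hconc δ hδ0 (ε / 4) (by positivity)
  have hηβ : 0 < η ^ (-β) := Real.rpow_pos_of_pos hη0 _
  set D := (2 * η ^ (-β)) ^ 2 with hD
  have hD0 : 0 < D := by positivity
  -- The three bounds serve the downward deviation, the quadratic loss in Bonferroni's inequality,
  -- and the event of two jumps above `η * x`, whose probability is at most `D * q ^ 2`.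
  refine ⟨min κ (min (ε / 4) (ε / 4 / D)), by positivity, ?_⟩
  filter_upwards [h, eventually_gt_atTop 0,
    eventually_tail_mul_le hXrv hη0 (r := 2 * η ^ (-β)) (by linarith),
    eventually_tail_mul_le hXrv (by linarith) hδup,
    eventually_le_tail_mul hXrv (by linarith) hδlow] with x hx hx0 hFη hFup hFlow n hn
  have hn1 : n * tail P (X 0) x ≤ κ := hn.trans (min_le_left _ _)
  have hn2 : n * tail P (X 0) x ≤ ε / 4 := hn.trans ((min_le_right _ _).trans (min_le_left _ _))
  have hn3 : n * tail P (X 0) x ≤ ε / 4 / D :=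
    hn.trans ((min_le_right _ _).trans (min_le_right _ _))
  have hq0 : 0 ≤ n * tail P (X 0) x := mul_nonneg (Nat.cast_nonneg n) (tail_nonneg _)
  set q := n * tail P (X 0) x with hq
  obtain ⟨hT1, hT2⟩ := hx n
  have hup1 : P.real {ω | x < partialSum X n ω - n * m} ≤
      P.real {ω | ∃ i ∈ Finset.range n, (1 - δ) * x < X i ω} +
      P.real {ω | (∃ i ∈ Finset.range n, ∃ j ∈ Finset.range n,
          i ≠ j ∧ η * x < X i ω ∧ η * x < X j ω) ∨
        δ * x < ∑ i ∈ Finset.range n, trunc (η * x) (X i ω) - n * m} := by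
    apply measureReal_le_add_of_ae
    filter_upwards [ae_all_iff.2 hX0] with ω hω hlt
    exact exists_large_or_of_lt_sum (y := fun i => X i ω) (fun i _ => hω i) hx0.le hδ1.le hlt
  have hup2 := measureReal_le_add_of_ae (P := P)
    (p := fun ω => (∃ i ∈ Finset.range n, ∃ j ∈ Finset.range n,
          i ≠ j ∧ η * x < X i ω ∧ η * x < X j ω) ∨
        δ * x < ∑ i ∈ Finset.range n, trunc (η * x) (X i ω) - n * m) (ae_of_all _ fun ω hω => hω)
  have hup3 : P.real {ω | ∃ i ∈ Finset.range n, (1 - δ) * x < X i ω} ≤ (1 + ε / 4) * q := by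
    refine (measureReal_exists_lt_le hXident n _).trans ?_
    calc n * tail P (X 0) ((1 - δ) * x) ≤ n * ((1 + ε / 4) * tail P (X 0) x) := by gcongr
      _ = _ := by rw [hq]; ring
  have hup4 : P.real {ω | ∃ i ∈ Finset.range n, ∃ j ∈ Finset.range n,
      i ≠ j ∧ η * x < X i ω ∧ η * x < X j ω} ≤ ε / 4 * q := by
    refine (measureReal_exists_pair_le hXident hpair n _).trans ?_
    calc (n * tail P (X 0) (η * x)) ^ 2 ≤ (n * (2 * η ^ (-β) * tail P (X 0) x)) ^ 2 := by
          have := tail_nonneg (P := P) (Y := X 0) (η * x)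
          gcongr
      _ = D * q * q := by rw [hq, hD]; ring
      _ ≤ D * (ε / 4 / D) * q := by gcongr
      _ = ε / 4 * q := by field_simp
  have hlow1 : P.real {ω | ∃ i ∈ Finset.range n, (1 + δ) * x < X i ω} ≤
      P.real {ω | x < partialSum X n ω - n * m} +
      P.real {ω | ∑ i ∈ Finset.range n, trunc (η * x) (X i ω) - n * m ≤ -(δ * x)} := by
    apply measureReal_le_add_of_ae
    filter_upwards [ae_all_iff.2 hX0] with ω hω hlt
    exact lt_sum_or_of_exists_large (y := fun i => X i ω) (fun i _ => hω i) (by nlinarith) hlt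
  have hlow2 : (1 - ε / 4) * q - ε / 4 * q ≤
      P.real {ω | ∃ i ∈ Finset.range n, (1 + δ) * x < X i ω} := by
    refine le_trans ?_ (le_measureReal_exists_lt hXm hXident hpair n _)
    have h1 : (1 - ε / 4) * q ≤ n * tail P (X 0) ((1 + δ) * x) := by
      calc (1 - ε / 4) * q = n * ((1 - ε / 4) * tail P (X 0) x) := by rw [hq]; ring
        _ ≤ _ := by gcongr
    have h2 : (n * tail P (X 0) ((1 + δ) * x)) ^ 2 ≤ ε / 4 * q := by
      have h3 : n * tail P (X 0) ((1 + δ) * x) ≤ q := by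
        rw [hq]; gcongr; exact tail_antitone (by nlinarith)
      calc (n * tail P (X 0) ((1 + δ) * x)) ^ 2 ≤ q ^ 2 := by
            have := tail_nonneg (P := P) (Y := X 0) ((1 + δ) * x)
            gcongr
        _ = q * q := sq q
        _ ≤ ε / 4 * q := by gcongr
    linarith
  have hlow3 := hT2 hn1
  rw [abs_le]
  constructor <;> nlinarith

end BigJump

/-! ### Generating functions and the contribution of large indices to the mean -/

lemma pairwise_disjoint_fiber {Ω : Type*} {M : Ω → ℕ} :
    Pairwise (Function.onFun Disjoint fun n => {ω | M ω = n}) :=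
  fun _ _ hij => Set.disjoint_left.2 fun _ h1 h2 => hij (h1.symm.trans h2)

lemma iUnion_fiber {Ω : Type*} {M : Ω → ℕ} : ⋃ n, {ω | M ω = n} = Set.univ := by
  ext; simp

section GeneratingFunction

variable {Ω : Type*} [MeasurableSpace Ω] {P : Measure Ω} {M : Ω → ℕ}

lemma measurableSet_fiber (hM : Measurable M) (n : ℕ) : MeasurableSet {ω | M ω = n} :=
  hM (measurableSet_singleton n)

lemma hasSum_mean (hM : Measurable M) (hMint : Integrable (fun ω => (M ω : ℝ)) P) :
    HasSum (fun n : ℕ => P.real {ω | M ω = n} * n) (mean P M) := by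
  have h := hasSum_integral_iUnion (f := fun ω => (M ω : ℝ)) (measurableSet_fiber hM)
    pairwise_disjoint_fiber hMint.integrableOn
  rw [iUnion_fiber, setIntegral_univ] at h
  have hterm : ∀ n : ℕ, ∫ ω in {ω | M ω = n}, (M ω : ℝ) ∂P = P.real {ω | M ω = n} * n := by
    intro n
    rw [setIntegral_congr_fun (g := fun _ => (n : ℝ)) (measurableSet_fiber hM n)
      fun ω hω => congrArg Nat.cast hω, setIntegral_const, smul_eq_mul]
  simp only [hterm] at h
  exact h

/-- Convergence at `w` gives convergence of the differentiated series at any smaller `r ≥ 0`, since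
`n * r ^ (n - 1) * (w - r) ≤ w ^ n - r ^ n`. -/
lemma summable_deriv_pgf_of_lt {w r : ℝ} (hr : 0 ≤ r) (hrw : r < w)
    (h : Summable fun n : ℕ => P.real {ω | M ω = n} * w ^ n) :
    Summable fun n : ℕ => P.real {ω | M ω = n} * (n * r ^ (n - 1)) := by
  have hd : 0 < w - r := sub_pos.2 hrw
  refine Summable.of_nonneg_of_le (fun n => by positivity) (fun n => ?_)
    (h.mul_left (w - r)⁻¹)
  rw [mul_left_comm (w - r)⁻¹]
  refine mul_le_mul_of_nonneg_left ?_ measureReal_nonneg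
  rw [inv_mul_eq_div, le_div_iff₀ hd]
  have h1 : n * r ^ (n - 1) * (w - r) ≤ w ^ n - r ^ n := by
    rw [← (Commute.all w r).geom_sum₂_mul]
    gcongr
    calc (n : ℝ) * r ^ (n - 1) = ∑ i ∈ Finset.range n, r ^ i * r ^ (n - 1 - i) := by
          rw [Finset.sum_congr rfl fun i hi => ?_, Finset.sum_const, Finset.card_range,
            nsmul_eq_mul]
          rw [← pow_add]
          congr 1
          have := Finset.mem_range.1 hi
          omega
      _ ≤ _ := by gcongr
  linarith [pow_nonneg hr n]

lemma hasDerivAt_pgf {r z : ℝ} (hz : |z| < r)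
    (h : Summable fun n : ℕ => P.real {ω | M ω = n} * (n * r ^ (n - 1))) :
    HasDerivAt (pgf P M) (∑' n : ℕ, P.real {ω | M ω = n} * (n * z ^ (n - 1))) z := by
  have hr : 0 < r := (abs_nonneg z).trans_lt hz
  refine hasDerivAt_tsum_of_isPreconnected (t := Set.Ioo (-r) r) (y₀ := 0)
    (g' := fun n y => P.real {ω | M ω = n} * (n * y ^ (n - 1))) h isOpen_Ioo
    isPreconnected_Ioo (fun n y _ => (hasDerivAt_pow n y).const_mul _) (fun n y hy => ?_)
    ⟨by linarith, hr⟩ ?_ (abs_lt.1 hz)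
  · rw [norm_mul, norm_mul, norm_pow, Real.norm_of_nonneg measureReal_nonneg,
      Real.norm_of_nonneg (Nat.cast_nonneg n)]
    gcongr
    exact (abs_lt.2 hy).le
  · refine summable_of_ne_finset_zero (s := {0}) fun n hn => ?_
    simp [zero_pow (Finset.notMem_singleton.1 hn)]

/-- Where the generating function has a nonzero derivative, it has not reached the end of its
interval of convergence. -/
lemma exists_summable_of_deriv_pgf_ne_zero {z : ℝ} (h : deriv (pgf P M) z ≠ 0) :
    ∃ w, z < w ∧ Summable fun n : ℕ => P.real {ω | M ω = n} * w ^ n := by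
  -- If the series diverged everywhere to the right of `z`, its `tsum` would be the default value
  -- `0` there, and the right derivative at `z` would vanish.
  by_contra! hcon
  have hz : ∀ w, z < w → pgf P M w = 0 := fun w hw => tsum_eq_zero_of_not_summable (hcon w hw)
  have hd := differentiableAt_of_deriv_ne_zero h
  have h0 : pgf P M z = 0 := by
    have h1 : Tendsto (pgf P M) (𝓝[>] z) (𝓝 (pgf P M z)) :=
      hd.continuousAt.tendsto.mono_left nhdsWithin_le_nhds
    refine tendsto_nhds_unique h1 (tendsto_const_nhds.congr' ?_)
    filter_upwards [self_mem_nhdsWithin] with w hw using (hz w hw).symm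
  have h1 : HasDerivWithinAt (pgf P M) (deriv (pgf P M) z) (Set.Ici z) z :=
    hd.hasDerivAt.hasDerivWithinAt
  have h2 : HasDerivWithinAt (pgf P M) 0 (Set.Ici z) z := by
    refine (hasDerivWithinAt_const z (Set.Ici z) (0 : ℝ)).congr (fun w hw => ?_) h0
    rcases (Set.mem_Ici.1 hw).eq_or_lt with rfl | hw
    · exact h0
    · exact hz w hw
  exact h ((uniqueDiffWithinAt_Ici z).eq_deriv _ h1 h2)

/-- The part of the mean of `M` which comes from values `n` with `κ < n * q`. -/
noncomputable def meanAbove (P : Measure Ω) (M : Ω → ℕ) (κ q : ℝ) : ℝ :=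
  ∑' n : ℕ, {n : ℕ | κ < n * q}.indicator (fun n => P.real {ω | M ω = n} * n) n

lemma hasSum_meanAbove (hM : Measurable M) (hMint : Integrable (fun ω => (M ω : ℝ)) P)
    (κ q : ℝ) :
    HasSum ({n : ℕ | κ < n * q}.indicator (fun n : ℕ => P.real {ω | M ω = n} * n))
      (meanAbove P M κ q) :=
  ((hasSum_mean hM hMint).summable.indicator _).hasSum

/-- In `∑ P[M = n] * n * (1 - z ^ (n - 1))` every term is nonnegative. If `n * q > κ`, then `q ≤ κ /
2` absorbs the shift in the exponent: `(n - 1) * q ≥ κ / 2`, hence `z ^ (n - 1) ≤ exp (-(c * (κ /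
2)))`. -/
lemma meanAbove_le_of_le_one (hM : Measurable M) (hMint : Integrable (fun ω => (M ω : ℝ)) P)
    {κ c q z : ℝ} (hc : 0 < c) (hq : 0 < q) (hq2 : q ≤ κ / 2) (hz0 : 0 ≤ z)
    (hz : c * q ≤ 1 - z) :
    (1 - Real.exp (-(c * (κ / 2)))) * meanAbove P M κ q ≤ mean P M - deriv (pgf P M) z := by
  have hz1 : z < 1 := by nlinarith [mul_pos hc hq]
  have hS := hasSum_mean hM hMint
  have hS' : Summable fun n : ℕ => P.real {ω | M ω = n} * (n * (1 : ℝ) ^ (n - 1)) := by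
    simpa using hS.summable
  have hzs : Summable fun n : ℕ => P.real {ω | M ω = n} * (n * z ^ (n - 1)) := by
    refine Summable.of_nonneg_of_le (fun n => by positivity) (fun n => ?_) hS'
    gcongr
  rw [(hasDerivAt_pgf (by rwa [abs_of_nonneg hz0]) hS').deriv]
  refine hasSum_le (fun n => ?_) ((hasSum_meanAbove hM hMint κ q).mul_left _)
    (hS.sub hzs.hasSum)
  have hzn : z ^ (n - 1) ≤ 1 := pow_le_one₀ hz0 hz1.le
  have hw : 0 ≤ P.real {ω | M ω = n} * n := by positivity
  by_cases hn : κ < n * q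
  · rw [Set.indicator_of_mem (by exact hn)]
    have hn1 : 1 ≤ n := by
      rcases Nat.eq_zero_or_pos n with rfl | h
      · simp at hn; linarith
      · exact h
    have h1 : z ^ (n - 1) ≤ Real.exp (-(c * (κ / 2))) := by
      calc z ^ (n - 1) ≤ (Real.exp (-(c * q))) ^ (n - 1) := by
            gcongr
            linarith [Real.add_one_le_exp (-(c * q))]
        _ = Real.exp (-(c * ((n - 1 : ℕ) * q))) := by rw [← Real.exp_nat_mul]; ring_nf
        _ ≤ Real.exp (-(c * (κ / 2))) := by
            gcongr
            rw [Nat.cast_sub hn1]; push_cast; linarith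
    nlinarith
  · rw [Set.indicator_of_notMem (by exact hn)]
    nlinarith

/-- The counterpart to the right of `1`, with Bernoulli's inequality `z ^ (n - 1) ≥ 1 + (n - 1) * (z
- 1)` in place of the exponential bound. The nonzero derivative guarantees convergence beyond `z`,
so the series may be differentiated termwise. -/
lemma meanAbove_le_of_one_le (hM : Measurable M) (hMint : Integrable (fun ω => (M ω : ℝ)) P)
    {κ c q z : ℝ} (hc : 0 < c) (hq : 0 < q) (hq2 : q ≤ κ / 2) (hz : c * q ≤ z - 1)
    (hd : deriv (pgf P M) z ≠ 0) :
    c * (κ / 2) * meanAbove P M κ q ≤ deriv (pgf P M) z - mean P M := by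
  have hz1 : 1 < z := by nlinarith [mul_pos hc hq]
  obtain ⟨w, hzw, hw⟩ := exists_summable_of_deriv_pgf_ne_zero hd
  obtain ⟨r, hzr, hrw⟩ := exists_between hzw
  have hz0 : 0 ≤ z := by linarith
  rw [(hasDerivAt_pgf (by rwa [abs_of_nonneg hz0])
    (summable_deriv_pgf_of_lt (by linarith) hrw hw)).deriv]
  refine hasSum_le (fun n => ?_) ((hasSum_meanAbove hM hMint κ q).mul_left _)
    ((summable_deriv_pgf_of_lt hz0 hzw hw).hasSum.sub (hasSum_mean hM hMint))
  have hzn : 1 ≤ z ^ (n - 1) := one_le_pow₀ hz1.le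
  have hw : 0 ≤ P.real {ω | M ω = n} * n := by positivity
  by_cases hn : κ < n * q
  · rw [Set.indicator_of_mem (by exact hn)]
    have hn1 : 1 ≤ n := by
      rcases Nat.eq_zero_or_pos n with rfl | h
      · simp at hn; linarith
      · exact h
    have h1 : 1 + c * (κ / 2) ≤ z ^ (n - 1) := by
      have h2 := one_add_mul_le_pow (a := z - 1) (by linarith) (n - 1)
      rw [add_sub_cancel] at h2
      refine le_trans (add_le_add_right ?_ 1) h2
      calc c * (κ / 2) ≤ c * ((n - 1 : ℕ) * q) := by
            gcongr
            rw [Nat.cast_sub hn1]; push_cast; linarith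
        _ = (n - 1 : ℕ) * (c * q) := by ring
        _ ≤ _ := by gcongr
    nlinarith
  · rw [Set.indicator_of_notMem (by exact hn)]
    nlinarith

/-- If the derivative of the generating function at points `z t`, at distance at least `c * q t`
from `1`, is equivalent to the mean, then the mean comes from values small in comparison with
`1 / q t`. -/
lemma tendsto_meanAbove_div_mean {ι : Type*} {l : Filter ι} {N : ι → Ω → ℕ}
    (hN : ∀ t, Measurable (N t)) (hNint : ∀ t, Integrable (fun ω => (N t ω : ℝ)) P)
    (hmean : ∀ᶠ t in l, 0 < mean P (N t)) {q z : ι → ℝ} {c κ : ℝ} (hc : 0 < c) (hκ : 0 < κ)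
    (hq0 : ∀ t, 0 < q t) (hq : Tendsto q l (𝓝 0)) (hz0 : ∀ t, 0 ≤ z t)
    (hz : ∀ᶠ t in l, c * q t ≤ |z t - 1|)
    (hderiv : Tendsto (fun t => |deriv (pgf P (N t)) (z t) / mean P (N t) - 1|) l (𝓝 0)) :
    Tendsto (fun t => meanAbove P (N t) κ (q t) / mean P (N t)) l (𝓝 0) := by
  set a₁ := 1 - Real.exp (-(c * (κ / 2)))
  have ha₁ : 0 < a₁ := by
    rw [sub_pos, Real.exp_lt_one_iff]
    have : 0 < c * (κ / 2) := by positivity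
    linarith
  set b := min a₁ (c * (κ / 2))
  have hb : 0 < b := lt_min ha₁ (by positivity)
  have hlim := hderiv.const_mul b⁻¹
  rw [mul_zero] at hlim
  refine squeeze_zero' ?_ ?_ hlim
  · filter_upwards [hmean] with t ht
    exact div_nonneg (tsum_nonneg fun n => Set.indicator_nonneg (fun _ _ => by positivity) _) ht.le
  · filter_upwards [hmean, hz, hq.eventually_le_const (half_pos hκ),
      hderiv.eventually_lt_const one_pos] with t ht hzt hqt hdt
    have hA : 0 ≤ meanAbove P (N t) κ (q t) :=
      tsum_nonneg fun n => Set.indicator_nonneg (fun _ _ => by positivity) _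
    -- A zero derivative, in particular the default value at a point of non-differentiability, would
    -- put the relative error at `1`.
    have hd : deriv (pgf P (N t)) (z t) ≠ 0 := by
      intro h0
      simp [h0] at hdt
    have key : b * meanAbove P (N t) κ (q t) ≤ |deriv (pgf P (N t)) (z t) - mean P (N t)| := by
      rcases le_total (z t) 1 with h1 | h1
      · rw [abs_of_nonpos (by linarith)] at hzt
        have := meanAbove_le_of_le_one (hN t) (hNint t) hc (hq0 t) hqt (hz0 t) (by linarith)
        calc _ ≤ a₁ * meanAbove P (N t) κ (q t) := by gcongr; exact min_le_left _ _
          _ ≤ _ := this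
          _ ≤ _ := by rw [abs_sub_comm]; exact le_abs_self _
      · rw [abs_of_nonneg (by linarith)] at hzt
        have := meanAbove_le_of_one_le (hN t) (hNint t) hc (hq0 t) hqt hzt hd
        calc _ ≤ c * (κ / 2) * meanAbove P (N t) κ (q t) := by gcongr; exact min_le_right _ _
          _ ≤ _ := this
          _ ≤ _ := le_abs_self _
    rw [div_sub_one ht.ne', abs_div, abs_of_pos ht, ← mul_div_assoc]
    gcongr
    rwa [inv_mul_eq_div, le_div_iff₀' hb]

end GeneratingFunction

/-! ### Lower bounds for the distance of the transform from one -/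

section Transform

variable {Ω : Type*} [MeasurableSpace Ω] {P : Measure Ω} {Y : Ω → ℝ} {β : ℝ}

lemma one_add_a_nonneg (s : ℝ) : 0 ≤ 1 + a P Y β s := by
  unfold a
  split_ifs <;> rw [add_sub_cancel] <;> exact integral_nonneg fun ω => Real.exp_nonneg _

variable [IsProbabilityMeasure P]

lemma integrable_exp_neg_mul_sub (hY : Measurable Y) (hY0 : ∀ᵐ ω ∂P, 0 ≤ Y ω) {s : ℝ}
    (hs : 0 ≤ s) (m : ℝ) : Integrable (fun ω => Real.exp (-s * (Y ω - m))) P := by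
  refine Integrable.of_bound (by fun_prop) (Real.exp (s * m)) ?_
  filter_upwards [hY0] with ω hω
  rw [Real.norm_of_nonneg (Real.exp_nonneg _)]
  refine Real.exp_le_exp.2 ?_
  nlinarith

lemma mul_tail_le_integral {f : Ω → ℝ} {c u : ℝ} (hY : Measurable Y) (hf : Integrable f P)
    (hf0 : ∀ᵐ ω ∂P, 0 ≤ f ω) (hfc : ∀ ω, u < Y ω → c ≤ f ω) :
    c * tail P Y u ≤ ∫ ω, f ω ∂P := by
  have hm : MeasurableSet {ω | u < Y ω} := measurableSet_lt measurable_const hY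
  rw [tail, mul_comm, ← smul_eq_mul, ← integral_indicator_const c hm]
  refine integral_mono_ae ((integrable_const c).indicator hm) hf ?_
  filter_upwards [hf0] with ω hω
  by_cases h : u < Y ω
  · rw [Set.indicator_of_mem (by exact h)]; exact hfc ω h
  · rw [Set.indicator_of_notMem (by exact h)]; exact hω

/-- The integrand of `-a(s) = E[1 - exp (-s * Y)]` is nonnegative, and at least `1 - exp (-1)` where
`s * Y > 1`. -/
lemma mul_tail_le_neg_a (hY : Measurable Y) (hY0 : ∀ᵐ ω ∂P, 0 ≤ Y ω) (hβ : β < 1) {s : ℝ}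
    (hs : 0 < s) : (1 - Real.exp (-1)) * tail P Y (1 / s) ≤ -a P Y β s := by
  have hi : Integrable (fun ω => Real.exp (-s * Y ω)) P := by
    simpa using integrable_exp_neg_mul_sub hY hY0 hs.le 0
  have h : -a P Y β s = ∫ ω, (1 - Real.exp (-s * Y ω)) ∂P := by
    rw [integral_sub (integrable_const _) hi, a, if_pos hβ, laplace]
    simp
  rw [h]
  refine mul_tail_le_integral hY ((integrable_const _).sub hi) ?_ fun ω hω => ?_
  · filter_upwards [hY0] with ω hω
    rw [sub_nonneg, Real.exp_le_one_iff]
    nlinarith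
  · rw [div_lt_iff₀' hs] at hω
    gcongr
    linarith

/-- Centering allows a linear term to be added for free: `a(s) = E[exp (-u) - 1 + u]` with `u = s *
(Y - E[Y])`. The integrand is nonnegative by convexity and at least `exp (-1)` where `u > 1`. -/
lemma mul_tail_le_a (hY : Measurable Y) (hY0 : ∀ᵐ ω ∂P, 0 ≤ Y ω) (hYi : Integrable Y P)
    (hβ : 1 ≤ β) {s : ℝ} (hs : 0 < s) :
    Real.exp (-1) * tail P Y (1 / s + ∫ ω, Y ω ∂P) ≤ a P Y β s := by
  set m := ∫ ω, Y ω ∂P with hm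
  have hi := integrable_exp_neg_mul_sub hY hY0 hs.le m
  have hi2 : Integrable (fun ω => s * (Y ω - m)) P := (hYi.sub (integrable_const m)).const_mul s
  have hi3 : Integrable (fun ω => s * (Y ω - m) - 1) P := hi2.sub (integrable_const 1)
  have h : a P Y β s = ∫ ω, (Real.exp (-s * (Y ω - m)) + (s * (Y ω - m) - 1)) ∂P := by
    rw [integral_add hi hi3, integral_sub hi2 (integrable_const 1), integral_const_mul,
      integral_sub hYi (integrable_const m), a, if_neg (not_lt.2 hβ), laplace]
    simp [← hm, sub_eq_add_neg]
  rw [h]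
  refine mul_tail_le_integral hY (hi.add hi3) (ae_of_all _ fun ω => ?_) fun ω hω => ?_
  · have := Real.add_one_le_exp (-s * (Y ω - m))
    linarith
  · have h1 : 1 < s * (Y ω - m) := by
      rw [← lt_sub_iff_add_lt, div_lt_iff₀' hs] at hω; exact hω
    -- This is the tangent to `exp (-u)` at `u = 1`, where `exp (-u) - 1 + u` equals `exp (-1)`.
    have h2 := Real.add_one_le_exp (-s * (Y ω - m) + 1)
    have h3 : Real.exp (-s * (Y ω - m)) = Real.exp (-s * (Y ω - m) + 1) * Real.exp (-1) := by
      rw [← Real.exp_add]; ring_nf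
    have h4 : Real.exp (-1) ≤ 1 := Real.exp_le_one_iff.2 (by norm_num)
    rw [h3]
    nlinarith [Real.exp_pos (-1)]

end Transform

/-! ### From a fixed to a random number of summands -/

section RandomIndex

variable {Ω : Type*} [MeasurableSpace Ω] {P : Measure Ω} [IsProbabilityMeasure P]
  {X : ℕ → Ω → ℝ} {M : Ω → ℕ}

/-- Independence of `M` from the whole sequence factorizes each event `{M = n, S_n - b n > x}`. -/
lemma hasSum_tail_partialSum_sub (hXm : ∀ k, Measurable (X k)) (hM : Measurable M)
    (hMX : IndepFun M (fun ω k => X k ω) P) (b : ℕ → ℝ) (x : ℝ) :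
    HasSum (fun n : ℕ => P.real {ω | M ω = n} * P.real {ω | x < partialSum X n ω - b n})
      (tail P (fun ω => partialSum X (M ω) ω - b (M ω)) x) := by
  have hpm : ∀ n, Measurable (fun y : ℕ → ℝ => ∑ k ∈ Finset.range n, y k) := fun n => by fun_prop
  have hS : ∀ n, MeasurableSet {ω | x < partialSum X n ω - b n} := fun n =>
    measurableSet_lt measurable_const
      ((Finset.measurable_fun_sum _ fun k _ => hXm k).sub measurable_const)
  have hterm : ∀ n : ℕ, P ({ω | M ω = n} ∩ {ω | x < partialSum X n ω - b n}) =
      P {ω | M ω = n} * P {ω | x < partialSum X n ω - b n} := fun n =>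
    hMX.measure_inter_preimage_eq_mul {n} {y | x < ∑ k ∈ Finset.range n, y k - b n}
      (measurableSet_singleton n) (measurableSet_lt measurable_const ((hpm n).sub_const _))
  have hU : {ω | x < partialSum X (M ω) ω - b (M ω)} =
      ⋃ n, {ω | M ω = n} ∩ {ω | x < partialSum X n ω - b n} := by
    ext ω; simp
  have hdisj : Pairwise (Function.onFun Disjoint
      fun n => {ω | M ω = n} ∩ {ω | x < partialSum X n ω - b n}) := fun i j hij =>
    (pairwise_disjoint_fiber hij).mono Set.inter_subset_left Set.inter_subset_left
  have hmeas : P {ω | x < partialSum X (M ω) ω - b (M ω)} =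
      ∑' n : ℕ, P {ω | M ω = n} * P {ω | x < partialSum X n ω - b n} := by
    rw [hU, measure_iUnion hdisj fun n => (measurableSet_fiber hM n).inter (hS n)]
    exact tsum_congr hterm
  have := ENNReal.hasSum_toReal (hmeas ▸ measure_ne_top P _)
  rw [← ENNReal.tsum_toReal_eq fun n => by finiteness, ← hmeas] at this
  simpa only [ENNReal.toReal_mul, tail, Measure.real] using this

/-- Comparison of the tail of a random sum with `E[M] * P[X > x]`, given such a comparison for
the sums of a fixed number `n` of summands with `n * q` small. -/
lemma abs_tail_sub_le (hXm : ∀ k, Measurable (X k)) (hM : Measurable M)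
    (hMint : Integrable (fun ω => (M ω : ℝ)) P) (hMX : IndepFun M (fun ω k => X k ω) P)
    (b : ℕ → ℝ) {x F q κ ε C : ℝ} (hF : 0 ≤ F) (hε : 0 ≤ ε) (hq : F ≤ q)
    (hbound : ∀ n : ℕ, P.real {ω | x < partialSum X n ω - b n} ≤ C * (n * F))
    (hsmall : ∀ n : ℕ, n * F ≤ κ →
      |P.real {ω | x < partialSum X n ω - b n} - n * F| ≤ ε * (n * F)) :
    |tail P (fun ω => partialSum X (M ω) ω - b (M ω)) x - mean P M * F| ≤
      (ε * mean P M + (C + 1) * meanAbove P M κ q) * F := by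
  have h1 := (hasSum_tail_partialSum_sub hXm hM hMX b x).sub ((hasSum_mean hM hMint).mul_right F)
  have h2 := (((hasSum_mean hM hMint).mul_left ε).add
    ((hasSum_meanAbove hM hMint κ q).mul_left (C + 1))).mul_right F
  rw [← h1.tsum_eq, ← Real.norm_eq_abs]
  refine tsum_of_norm_bounded h2 fun n => ?_
  set w := P.real {ω | M ω = n}
  set p := P.real {ω | x < partialSum X n ω - b n}
  have hw : 0 ≤ w := measureReal_nonneg
  have hp : 0 ≤ p := measureReal_nonneg
  have hnF : 0 ≤ (n : ℝ) * F := by positivity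
  rw [Real.norm_eq_abs, show w * p - w * n * F = w * (p - n * F) by ring, abs_mul,
    abs_of_nonneg hw]
  by_cases hn : κ < n * q
  · rw [Set.indicator_of_mem (by exact hn)]
    -- For large `n` the crude bound suffices: `p` and `n * F` are nonnegative and at most `C * (n *
    -- F)` and `n * F`.
    have h3 : |p - n * F| ≤ (C + 1) * (n * F) := by
      rw [abs_le]
      constructor <;> linarith [hbound n]
    calc w * |p - n * F| ≤ w * ((C + 1) * (n * F)) := by gcongr
      _ ≤ ε * w * n * F + w * ((C + 1) * (n * F)) := le_add_of_nonneg_left (by positivity)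
      _ = _ := by ring
  · rw [Set.indicator_of_notMem (by exact hn), mul_zero, add_zero]
    have h3 := hsmall n (le_trans (by gcongr) (not_lt.1 hn))
    calc w * |p - n * F| ≤ w * (ε * (n * F)) := by gcongr
      _ = _ := by ring

end RandomIndex

/-! ### Assembly of the estimates -/

section Main

variable {Ω : Type*} [MeasurableSpace Ω] {P : Measure Ω} {X : ℕ → Ω → ℝ}
  {β : ℝ}

lemma centering_eq_mul (hXident : ∀ k, IdentDistrib (X k) (X 0) P P)
    (hXi : ¬ β < 1 → Integrable (X 0) P) (n : ℕ) :
    centering P X β n = n * if β < 1 then 0 else ∫ ω, X 0 ω ∂P := by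
  unfold centering partialSum
  split_ifs with h
  · simp
  · rw [integral_finsetSum _ fun i _ => (hXident i).integrable_iff.2 (hXi h)]
    simp [fun i => (hXident i).integral_eq]

variable [IsProbabilityMeasure P]

lemma truncatedSumsConcentrate (hβ2 : β < 2) (hβ1 : β ≠ 1) (hXm : ∀ k, Measurable (X k))
    (hXident : ∀ k, IdentDistrib (X k) (X 0) P P)
    (hpair : Pairwise fun i j => IndepFun (X i) (X j) P) (hX0 : ∀ᵐ ω ∂P, 0 ≤ X 0 ω)
    (hXrv : RegularlyVarying (tail P (X 0)) β) :
    TruncatedSumsConcentrate P X (if β < 1 then 0 else ∫ ω, X 0 ω ∂P) := by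
  split_ifs with h
  · exact truncatedSumsConcentrate_of_lt_one hXm hXident hXrv h
  · exact truncatedSumsConcentrate_of_one_lt hXm hXident hpair hX0 hXrv
      (lt_of_le_of_ne (not_lt.1 h) hβ1.symm) hβ2

/-- The distance of the transform of the summand from `1` dominates the tail. -/
lemma exists_eventually_mul_tail_le_abs_a {Y : Ω → ℝ} (hβ1 : β ≠ 1) (hY : Measurable Y)
    (hY0 : ∀ᵐ ω ∂P, 0 ≤ Y ω) (hrv : RegularlyVarying (tail P Y) β) :
    ∃ c > 0, ∀ᶠ s in 𝓝[>] (0 : ℝ), c * tail P Y (1 / s) ≤ |a P Y β (2 * s)| := by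
  rcases hβ1.lt_or_gt with hβ | hβ
  · refine ⟨1 - Real.exp (-1), sub_pos.2 (Real.exp_lt_one_iff.2 (by norm_num)), ?_⟩
    filter_upwards [self_mem_nhdsWithin] with s (hs : 0 < s)
    refine le_trans ?_ ((mul_tail_le_neg_a hY hY0 hβ (mul_pos two_pos hs)).trans (neg_le_abs _))
    refine mul_le_mul_of_nonneg_left (tail_antitone ?_) ?_
    · gcongr; linarith
    · rw [sub_nonneg, Real.exp_le_one_iff]; norm_num
  · refine ⟨Real.exp (-1), Real.exp_pos _, ?_⟩
    have hYi := integrable_of_regularlyVarying hY hY0 hrv hβ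
    -- The factor `2` in `a(2 * s)` absorbs the centering: `1 / (2 * s) + E[Y] ≤ 1 / s` once `1 / s
    -- ≥ 2 * E[Y]`.
    filter_upwards [self_mem_nhdsWithin,
      tendsto_inv_nhdsGT_zero.eventually_ge_atTop (2 * ∫ ω, Y ω ∂P)] with s (hs : 0 < s) hs2
    refine le_trans ?_ ((mul_tail_le_a hY hY0 hYi hβ.le (mul_pos two_pos hs)).trans (le_abs_self _))
    refine mul_le_mul_of_nonneg_left (tail_antitone ?_) (Real.exp_nonneg _)
    have : 1 / (2 * s) = s⁻¹ / 2 := by field_simp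
    rw [this, one_div]
    linarith

end Main

end RandomSum

open RandomSum in
theorem mainTheorem6 {Ω : Type*} [MeasurableSpace Ω] (P : Measure Ω) [IsProbabilityMeasure P]
    (β : ℝ) (hβ : β ∈ Set.Ioo (0 : ℝ) 2) (hβ1 : β ≠ 1)
    (X : ℕ → Ω → ℝ) (hXm : ∀ k, Measurable (X k))
    (hXindep : iIndepFun X P) (hXident : ∀ k, IdentDistrib (X k) (X 0) P P)
    (hXnonneg : ∀ k, ∀ᵐ ω ∂P, 0 ≤ X k ω)
    (hXrv : RandomSum.RegularlyVarying (RandomSum.tail P (X 0)) β)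
    (N : ℝ≥0 → Ω → ℕ) (hNm : ∀ t, Measurable (N t))
    (hNX : ∀ t, IndepFun (N t) (fun ω k => X k ω) P)
    (hNint : ∀ t, Integrable (fun ω => (N t ω : ℝ)) P)
    (hNmean : Tendsto (fun t => RandomSum.mean P (N t)) atTop atTop)
    (s : ℝ≥0 → ℝ) (hs : Tendsto s atTop (𝓝[>] 0))
    (hderiv : ∀ l : ℝ, 0 < l →
      Tendsto (fun t => |deriv (RandomSum.pgf P (N t)) (1 + RandomSum.a P (X 0) β (l * s t)) /
        RandomSum.mean P (N t) - 1|) atTop (𝓝 0)) :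
    Tendsto (fun t => ⨆ x ∈ Set.Ici (1 / s t),
      ENNReal.ofReal |RandomSum.tail P (RandomSum.centeredRandomSum P X β (N t)) x /
        (RandomSum.mean P (N t) * RandomSum.tail P (X 0) x) - 1|) atTop (𝓝 0) := by
  have hpair : Pairwise fun i j => IndepFun (X i) (X j) P := fun i j hij => hXindep.indepFun hij
  have hcent : ∀ n, centering P X β n = n * if β < 1 then 0 else ∫ ω, X 0 ω ∂P :=
    centering_eq_mul hXident fun h => integrable_of_regularlyVarying (hXm 0) (hXnonneg 0) hXrv
      (lt_of_le_of_ne (not_lt.1 h) hβ1.symm)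
  have hconc := truncatedSumsConcentrate hβ.2 hβ1 hXm hXident hpair (hXnonneg 0) hXrv
  obtain ⟨C, hC, hbound⟩ := exists_tail_sum_le hXident hXnonneg hXrv hconc
  obtain ⟨c, hc, hca⟩ := exists_eventually_mul_tail_le_abs_a hβ1 (hXm 0) (hXnonneg 0) hXrv
  have hx : Tendsto (fun t => 1 / s t) atTop atTop := by
    simp only [one_div]
    exact tendsto_inv_nhdsGT_zero.comp hs
  have hmean : ∀ᶠ t in atTop, 0 < mean P (N t) := hNmean.eventually_gt_atTop 0
  rw [ENNReal.tendsto_nhds_zero]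
  intro e he
  obtain ⟨ε, hε, hεe⟩ : ∃ ε : ℝ, 0 < ε ∧ ENNReal.ofReal ε ≤ e := by
    obtain ⟨r, hr0, hr⟩ := ENNReal.lt_iff_exists_nnreal_btwn.1 he
    exact ⟨r, by exact_mod_cast hr0, by simpa using hr.le⟩
  obtain ⟨κ, hκ, hsmall⟩ :=
    exists_abs_tail_sum_sub_le hXm hXident hpair hXnonneg hXrv hconc (half_pos hε)
  -- The level `q t` is the tail at the left endpoint `1 / s t`, and `l = 2` matches the lower bound
  -- for `|a(2 * s)|`.
  have habove := tendsto_meanAbove_div_mean (κ := κ) hNm hNint hmean hc hκ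
    (q := fun t => tail P (X 0) (1 / s t)) (fun t => tail_pos hXrv _)
    ((tendsto_tail_atTop (hXm 0)).comp hx) (fun t => one_add_a_nonneg _)
    (by simpa only [add_sub_cancel_left] using hs.eventually hca) (hderiv 2 two_pos)
  filter_upwards [hmean, hx.eventually (eventually_forall_ge_atTop.2 (hbound.and hsmall)),
    habove.eventually_lt_const (u := ε / 2 / (C + 1)) (by positivity)] with t htm htx htA
  refine le_trans (iSup₂_le fun x hxt => ENNReal.ofReal_le_ofReal ?_) hεe
  obtain ⟨h1, h2⟩ := htx x hxt
  have hFx := tail_pos hXrv x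
  -- Uniformity enters here: the tail at any `x ≥ 1 / s t` is at most `q t`, so the same `meanAbove`
  -- bounds the error for every `x`.
  have key := abs_tail_sub_le hXm (hNm t) (hNint t) (hNX t) (centering P X β) hFx.le
    (half_pos hε).le (tail_antitone hxt) (fun n => by rw [hcent]; exact h1 n)
    (fun n => by rw [hcent]; exact h2 n)
  have hd : 0 < mean P (N t) * tail P (X 0) x := mul_pos htm hFx
  rw [div_sub_one hd.ne', abs_div, abs_of_pos hd, div_le_iff₀ hd]
  refine key.trans ?_
  rw [← mul_assoc]
  refine mul_le_mul_of_nonneg_right ?_ hFx.le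
  rw [div_lt_iff₀ htm] at htA
  have h3 : (C + 1) * meanAbove P (N t) κ (tail P (X 0) (1 / s t)) ≤ ε / 2 * mean P (N t) := by
    calc _ ≤ (C + 1) * (ε / 2 / (C + 1) * mean P (N t)) := by gcongr
      _ = _ := by field_simp
  linarith
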